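/- **Theorem 1 (Convergence of the linearized augmented Lagrangian iteration for localized LRR).** Let $\mathbf X_1,\dots,\mathbf X_N\in\mathbb R^{d\times p}$ satisfy $\mathbf X_i^T\mathbf X_i=I_p$, so that they represent points $[\mathbf X_i]$ of the Grassmann manifold $\mathcal G(p,d)$. For all $i,j$ let $\mathbf H_{ij}=\mathrm{Log}_{[\mathbf X_i]}([\mathbf X_j])$ be a Riemannian logarithm: $\mathbf H_{ij}=\mathbf U\,\mathrm{diag}(\mathbf s)\,\mathbf V^T$ is a thin SVD with $\mathbf s\in[0,\pi/2]^p$, $\mathbf X_i^T\mathbf H_{ij}=0$, and for some orthogonal $\mathbf Q$ $$\mathbf V\cos(\mathbf S)\mathbf Q^T=\mathbf X_i^T\mathbf X_j,\qquad \mathbf U\sin(\mathbf S)\mathbf Q^T=\mathbf X_j-\mathbf X_i\mathbf X_i^T\mathbf X_j,\qquad \mathbf S=\mathrm{diag}(\mathbf s)$$ (if $\mathbf X_i^T\mathbf X_j$ is invertible, $\mathbf H_{ij}=\mathbf U\arctan(\Sigma)\mathbf V^T$ for an SVD $\mathbf U\Sigma\mathbf V^T=(\mathbf X_j-\mathbf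 X_i\mathbf X_i^T\mathbf X_j)(\mathbf X_i^T\mathbf X_j)^{-1}$). Let $\mathbf B_i\in\mathbb R^{N\times N}$ have entries $(\mathbf B_i)_{jk}=\mathrm{trace}(\mathbf H_{ij}^T\mathbf H_{ik})$. For each $i$ let $\mathcal N_i\subseteq\{1,\dots,N\}$ be a neighbourhood containing at least one index $j\neq i$; let $\Omega=\{(i,j): j=i \text{ or } j\notin\mathcal N_i\}$, and let $P_\Omega$ be the projection that keeps the entries of a matrix with index in $\Omega$ and sets the others to $0$. For $\lambda>0$ consider the problem $$\min_{\mathbf W\in\mathbb R^{N\times N}}\ \tfrac12\sum_{i=1}^N\mathbf w_i\mathbf B_i\mathbf w_i^T+\lambda\|\mathbf W\|_*\quad\text{s.t. } \mathbf W\mathbf 1=\mathbf 1,\ P_\Omega(\mathbf W)=0,\tag{P}$$ where $\mathbf w_i$ is the $i$-th row of $\mathbf W$, $\|\cdot\|_*$ is the nuclear norm and $\mathbf 1$ is the all-ones vector. Given $\eta_W$ and a sequence $(\beta^{(k)})_{k\ge0}$ with $\beta^{(0)}>0$, let $\mathbf W^{(0)}=0$, $\mathbf Y_1^{(0)}=0$,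 $\mathbf Y_2^{(0)}=0$ and, for $k\ge0$, $$\mathbf G^{(k)}=\mathbf W^{(k)}\odot\mathcal B+\mathbf Y_1^{(k)}\mathbf 1^T+\beta^{(k)}(\mathbf W^{(k)}\mathbf 1-\mathbf 1)\mathbf 1^T+P_\Omega(\mathbf Y_2^{(k)})+\beta^{(k)}P_\Omega(\mathbf W^{(k)}),$$ $$\mathbf W^{(k+1)}=\arg\min_{\mathbf W}\ \lambda\|\mathbf W\|_*+\frac{\eta_W\beta^{(k)}}2\Big\|\mathbf W-\Big(\mathbf W^{(k)}-\frac1{\eta_W\beta^{(k)}}\mathbf G^{(k)}\Big)\Big\|_F^2,$$ $$\mathbf Y_1^{(k+1)}=\mathbf Y_1^{(k)}+\beta^{(k)}(\mathbf W^{(k+1)}\mathbf 1-\mathbf 1),\qquad P_\Omega(\mathbf Y_2^{(k+1)})=P_\Omega(\mathbf Y_2^{(k)})+\beta^{(k)}P_\Omega(\mathbf W^{(k+1)}),$$ where the $i$-th row of $\mathbf W\odot\mathcal B$ is $\mathbf w_i\mathbf B_i$. Let $\|\cdot\|$ be the spectral norm and let $C_0>0$ be any constant. If $\eta_W\ge\max_i\|\mathbf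 B_i\|^2+N+1$, $\sum_{k=1}^\infty 1/\beta^{(k)}=+\infty$, and for all $k\ge 0$ $$\beta^{(k+1)}-\beta^{(k)}>C_0\,\frac{\sum_{i=1}^N\|\mathbf B_i\|^2}{\eta_W-\max_i\|\mathbf B_i\|^2-N},$$ then the sequence $(\mathbf W^{(k)})$ converges to an optimal solution of (P). -/

import Mathlib

open Filter Topology
open scoped Matrix

namespace LGLRR

/-- `X` is a point of the Stiefel manifold `ST(p, d)`: a `d × p` matrix with orthonormal columns.
It represents the point `span X` of the Grassmann manifold `G(p, d)`. -/
def IsStiefel {d p : ℕ} (X : Matrix (Fin d) (Fin p) ℝ) : Prop :=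
  Xᵀ * X = 1

/-- `H` is (the horizontal lift at `X` of) a Riemannian logarithm `Log_[X] [Y]` on the Grassmann
manifold, for Stiefel representatives `X` and `Y`.  With a thin singular value decomposition
`H = U diag(s) Vᵀ`, it is a tangent vector at `[X]` (`Xᵀ H = 0`), its singular values lie in
`[0, π/2]`, and `Exp_[X] H = [Y]`, that is, `Y = X V cos(s) Qᵀ + U sin(s) Qᵀ` for some
orthogonal `Q`, split into its components along `X` and orthogonal to `X`.

If `Xᵀ Y` is invertible this says exactly that `H = U arctan(Σ) Vᵀ`, where `U Σ Vᵀ` is a singular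
value decomposition of `(Y - X Xᵀ Y) (Xᵀ Y)⁻¹`, and `H` is unique.  If `Xᵀ Y` is singular (`[Y]`
is in the cut locus of `[X]`), several minimal logarithms exist, and each of them is allowed. -/
def IsGrassmannLog {d p : ℕ} (X Y H : Matrix (Fin d) (Fin p) ℝ) : Prop :=
  ∃ (U : Matrix (Fin d) (Fin p) ℝ) (s : Fin p → ℝ) (V Q : Matrix (Fin p) (Fin p) ℝ),
    Uᵀ * U = 1 ∧ Vᵀ * V = 1 ∧ Qᵀ * Q = 1 ∧
    (∀ i, 0 ≤ s i ∧ s i ≤ Real.pi / 2) ∧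
    H = U * Matrix.diagonal s * Vᵀ ∧
    Xᵀ * H = 0 ∧
    V * Matrix.diagonal (fun i => Real.cos (s i)) * Qᵀ = Xᵀ * Y ∧
    U * Matrix.diagonal (fun i => Real.sin (s i)) * Qᵀ = Y - X * Xᵀ * Y

/-- The matrices `B_i`: the `(j, k)` entry of `B_i` is `trace (Log_{X_i}(X_j)ᵀ Log_{X_i}(X_k))`,
where `H i j` is `Log_{X_i}(X_j)`. -/
def gramB {N d p : ℕ} (H : Fin N → Fin N → Matrix (Fin d) (Fin p) ℝ) (i : Fin N) :
    Matrix (Fin N) (Fin N) ℝ :=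
  Matrix.of fun j k => ((H i j)ᵀ * H i k).trace

/-- The index set `Ω = {(i, j) : j = i or X_j is not in the neighbourhood of X_i}`. -/
def Omega {N : ℕ} (nbr : Fin N → Set (Fin N)) : Set (Fin N × Fin N) :=
  {ij | ij.2 = ij.1 ∨ ij.2 ∉ nbr ij.1}

open Classical in
/-- The projection `P_Ω` that keeps the entries with index in `Ω` and sets the others to zero. -/
noncomputable def projOn {N : ℕ} (Ω : Set (Fin N × Fin N)) (W : Matrix (Fin N) (Fin N) ℝ) :
    Matrix (Fin N) (Fin N) ℝ :=
  Matrix.of fun i j => if (i, j) ∈ Ω then W i j else 0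

/-- The spectral norm of a matrix, i.e. its operator norm for the Euclidean norm. -/
noncomputable def specNorm {N : ℕ} (A : Matrix (Fin N) (Fin N) ℝ) : ℝ :=
  ‖Matrix.toEuclideanCLM (n := Fin N) (𝕜 := ℝ) A‖

/-- The nuclear norm of a matrix: the sum of its singular values. -/
noncomputable def nuclearNorm {N : ℕ} (A : Matrix (Fin N) (Fin N) ℝ) : ℝ :=
  ∑ i : Fin N, (Matrix.toEuclideanLin A).singularValues i

/-- The square of the Frobenius norm. -/
def frobSq {N : ℕ} (A : Matrix (Fin N) (Fin N) ℝ) : ℝ :=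
  ∑ i, ∑ j, A i j ^ 2

/-- The objective `½ ∑ i, w_i B_i w_iᵀ + lam ‖W‖_*`, where `w_i` is the `i`-th row of `W`. -/
noncomputable def objective {N : ℕ} (B : Fin N → Matrix (Fin N) (Fin N) ℝ) (lam : ℝ)
    (W : Matrix (Fin N) (Fin N) ℝ) : ℝ :=
  1 / 2 * ∑ i, W i ⬝ᵥ (B i *ᵥ W i) + lam * nuclearNorm W

/-- The constraints `W 1 = 1` and `P_Ω(W) = 0`. -/
def IsFeasible {N : ℕ} (Ω : Set (Fin N × Fin N)) (W : Matrix (Fin N) (Fin N) ℝ) : Prop :=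
  W *ᵥ 1 = 1 ∧ projOn Ω W = 0

/-- `W` is an optimal solution of the localized LRR problem. -/
def IsOptimal {N : ℕ} (B : Fin N → Matrix (Fin N) (Fin N) ℝ) (lam : ℝ)
    (Ω : Set (Fin N × Fin N)) (W : Matrix (Fin N) (Fin N) ℝ) : Prop :=
  IsFeasible Ω W ∧ ∀ W', IsFeasible Ω W' → objective B lam W ≤ objective B lam W'

/-- The gradient at `W` of the smooth part of the augmented Lagrangian with multipliers `Y₁`, `Y₂`
and penalty `b`:
`W ⊙ B + Y₁ 1ᵀ + b (W 1 - 1) 1ᵀ + P_Ω(Y₂) + b P_Ω(W)`, where row `i` of `W ⊙ B` is `w_i B_i`. -/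
noncomputable def gradF {N : ℕ} (B : Fin N → Matrix (Fin N) (Fin N) ℝ)
    (Ω : Set (Fin N × Fin N)) (b : ℝ) (W : Matrix (Fin N) (Fin N) ℝ)
    (Y₁ : Fin N → ℝ) (Y₂ : Matrix (Fin N) (Fin N) ℝ) : Matrix (Fin N) (Fin N) ℝ :=
  Matrix.of (fun i => W i ᵥ* B i) + Matrix.vecMulVec Y₁ 1
    + b • Matrix.vecMulVec (W *ᵥ 1 - 1) 1 + projOn Ω Y₂ + b • projOn Ω W

/-- The sequences `W`, `Y₁`, `Y₂` are generated by the linearized augmented Lagrangian iteration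
with penalty parameters `β k` and proximal constant `η`, started at zero.  Entries of `Y₂`
outside `Ω` play no role and are left free after the start. -/
structure IsIteration {N : ℕ} (B : Fin N → Matrix (Fin N) (Fin N) ℝ) (lam η : ℝ)
    (Ω : Set (Fin N × Fin N)) (β : ℕ → ℝ) (W : ℕ → Matrix (Fin N) (Fin N) ℝ)
    (Y₁ : ℕ → Fin N → ℝ) (Y₂ : ℕ → Matrix (Fin N) (Fin N) ℝ) : Prop where
  W_zero : W 0 = 0
  Y₁_zero : Y₁ 0 = 0
  Y₂_zero : Y₂ 0 = 0
  /-- `W (k+1)` minimizes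
  `lam ‖Z‖_* + (η β_k / 2) ‖Z - (W_k - (η β_k)⁻¹ ∂F(W_k))‖_F²` over all matrices `Z`. -/
  W_step : ∀ k, IsMinOn
    (fun Z => lam * nuclearNorm Z + η * β k / 2 *
      frobSq (Z - (W k - (η * β k)⁻¹ • gradF B Ω (β k) (W k) (Y₁ k) (Y₂ k))))
    Set.univ (W (k + 1))
  Y₁_step : ∀ k, Y₁ (k + 1) = Y₁ k + β k • (W (k + 1) *ᵥ 1 - 1)
  Y₂_step : ∀ k, projOn Ω (Y₂ (k + 1)) = projOn Ω (Y₂ k) + β k • projOn Ω (W (k + 1))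

end LGLRR

/-!
# Convergence of the linearized augmented Lagrangian iteration for localized LRR

Only the symmetry and positivity of the Gram matrices `B_i` matter. After vectorization the
problem is to minimize `½ ⟪x, T x⟫ + g x` subject to `A x = b`, with `T` positive semidefinite,
`g` a multiple of the nuclear norm (convex and coercive by `nuclearNorm_convex` and
`norm_le_nuclearNorm`), and `A W = (W 1, P_Ω W)`. A minimizer `x` exists and has a Lagrange
multiplier `y'` (`exists_isSaddle`).

The proof rests on the energy `η ‖w_k - x‖² + ‖y_k - y'‖² / β_k²`. By `energy_step`, each step
decreases it by at least `‖A w_k - b‖² + c ‖w_{k+1} - w_k‖² + (2 / β_k) G_k`, where `G_k ≥ 0` is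
the excess of the Lagrangian at `w_{k+1}`, provided `‖A d‖² + ⟪d, T d⟫ / β_k + c ‖d‖² ≤ η ‖d‖²`
for all `d`. This holds for large `k`: every row has an index outside `Ω`, so `‖A‖² < N + 1 ≤ η`
with a margin (`norm_constraintMap_sq_le`), and either `T = 0` or the growth condition forces `β_k
→ ∞`; this is why any `C₀ > 0` suffices.

Hence residuals and increments tend to zero, and as `∑ 1 / β_k = ∞`, the gaps `G_k` tend to zero
along a subsequence. A limit `v` of the iterates along it is optimal. For convergence of the whole
sequence the energy relative to `v` and a suitable multiplier must vanish along the subsequence,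
that is, `y_k / β_k` must tend to `lim 1 / β_k` times a multiplier of `v`. This is read off from
the proximal inequality divided by `β_k` (`exists_isSaddle_of_limit`): if `β` is bounded, a limit
of `y_k` is itself a multiplier of `v`, and if `β_k → ∞`, a limit of `y_k / β_k` lies in the range
of `A` and is orthogonal to it. Being eventually decreasing, the energy then tends to zero along
the whole sequence.
-/

namespace LGLRR

/-! ### Duality for the nuclear norm -/

section NuclearNorm

open Module
open scoped RealInnerProductSpace

variable {E : Type*} [NormedAddCommGroup E] [InnerProductSpace ℝ E] [FiniteDimensional ℝ E]

/-- A family satisfying Bessel's inequality.  Orthonormal families padded with zero vectors are of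
this kind, so that the dual description of the nuclear norm applies to rank-deficient maps. -/
def IsBesselFamily {ι : Type*} [Fintype ι] (u : ι → E) : Prop :=
  ∀ x, ∑ i, ⟪u i, x⟫ ^ 2 ≤ ‖x‖ ^ 2

/-- A singular value decomposition, reduced to what duality needs: the right singular vectors `v`
and the normalized nonzero images `u` of them. -/
theorem exists_singular_system (T : E →ₗ[ℝ] E) {n : ℕ} (hn : finrank ℝ E = n) :
    ∃ (v : OrthonormalBasis (Fin n) ℝ E) (u : Fin n → E), IsBesselFamily u ∧
      (∀ i, ‖T (v i)‖ = T.singularValues i) ∧ ∀ i, ⟪T (v i), u i⟫ = T.singularValues i := by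
  classical
  set v := T.isSymmetric_adjoint_comp_self.eigenvectorBasis hn with hv
  have hinner : ∀ i j, ⟪T (v i), T (v j)⟫ =
      if i = j then (T.singularValues i : ℝ) ^ 2 else 0 := by
    intro i j
    rw [← LinearMap.adjoint_inner_left]
    have h := T.isSymmetric_adjoint_comp_self.apply_eigenvectorBasis hn i
    rw [LinearMap.comp_apply] at h
    rw [← hv] at h
    rw [h, ← T.sq_singularValues_fin hn i, inner_smul_left,
      orthonormal_iff_ite.1 v.orthonormal i j]
    split_ifs <;> simp
  have hnorm : ∀ i, ‖T (v i)‖ = T.singularValues i := by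
    intro i
    have h := hinner i i
    rw [real_inner_self_eq_norm_sq, if_pos rfl] at h
    exact (sq_eq_sq₀ (norm_nonneg _) (T.singularValues_nonneg i)).1 h
  refine ⟨v, fun i => (T.singularValues i : ℝ)⁻¹ • T (v i), ?_, hnorm, ?_⟩
  · intro x
    set S : Finset (Fin n) := Finset.univ.filter fun i => T.singularValues i ≠ 0 with hS
    have hon : Orthonormal ℝ (fun i : S => (T.singularValues i.1 : ℝ)⁻¹ • T (v i.1)) := by
      rw [orthonormal_iff_ite]
      rintro ⟨i, hi⟩ ⟨j, hj⟩
      simp only [hS, Finset.mem_filter, Finset.mem_univ, true_and] at hi hj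
      rw [inner_smul_left, inner_smul_right, hinner]
      by_cases hij : i = j
      · subst hij
        simp only [if_true, RCLike.conj_to_real]
        field_simp
      · simp [hij]
    have h := hon.sum_inner_products_le (x := x) (s := Finset.univ)
    calc ∑ i : Fin n, ⟪(T.singularValues i : ℝ)⁻¹ • T (v i), x⟫ ^ 2
        = ∑ i ∈ S, ⟪(T.singularValues i : ℝ)⁻¹ • T (v i), x⟫ ^ 2 := by
          refine (Finset.sum_subset (Finset.subset_univ S) fun i _ hi => ?_).symm
          have : T.singularValues i = 0 := by simpa [hS] using hi
          simp [this]
      _ = ∑ i : S, ‖⟪(T.singularValues i.1 : ℝ)⁻¹ • T (v i.1), x⟫‖ ^ 2 := by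
          rw [← Finset.sum_coe_sort]
          simp
      _ ≤ ‖x‖ ^ 2 := h
  · intro i
    rw [inner_smul_right, hinner, if_pos rfl]
    by_cases h : T.singularValues i = 0
    · simp [h]
    · field_simp

/-- Half of the duality between the nuclear norm and the operator norm. -/
theorem sum_inner_le_sum_singularValues (T : E →ₗ[ℝ] E) {n : ℕ} (hn : finrank ℝ E = n)
    (v : OrthonormalBasis (Fin n) ℝ E) {u : Fin n → E} (hu : IsBesselFamily u) :
    ∑ i, ⟪T (v i), u i⟫ ≤ ∑ i : Fin n, T.singularValues i := by
  obtain ⟨w, -, -, hw, -⟩ := exists_singular_system T hn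
  have hexp : ∀ i, ⟪T (v i), u i⟫ = ∑ j, ⟪w j, v i⟫ * ⟪T (w j), u i⟫ := by
    intro i
    conv_lhs => rw [← w.sum_repr' (v i)]
    simp [sum_inner, inner_smul_left]
  simp_rw [hexp]
  rw [Finset.sum_comm]
  refine Finset.sum_le_sum fun j _ => ?_
  have hv1 : ∑ i, ⟪w j, v i⟫ ^ 2 = 1 := by
    have := v.sum_sq_norm_inner_left (w j)
    simpa using this
  have hu1 : ∑ i, ⟪T (w j), u i⟫ ^ 2 ≤ (T.singularValues j : ℝ) ^ 2 := by
    have := hu (T (w j))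
    rw [hw] at this
    simpa [real_inner_comm] using this
  have hcs := Finset.sum_mul_sq_le_sq_mul_sq Finset.univ (fun i => ⟪w j, v i⟫)
    (fun i => ⟪T (w j), u i⟫)
  rw [hv1, one_mul] at hcs
  exact (le_abs_self _).trans (abs_le_of_sq_le_sq (hcs.trans hu1) (T.singularValues_nonneg j))

theorem sum_singularValues_convex (S T : E →ₗ[ℝ] E) {n : ℕ} (hn : finrank ℝ E = n)
    {a b : ℝ} (ha : 0 ≤ a) (hb : 0 ≤ b) :
    ∑ i : Fin n, (a • S + b • T).singularValues i ≤
      a * ∑ i : Fin n, S.singularValues i + b * ∑ i : Fin n, T.singularValues i := by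
  obtain ⟨v, u, hu, -, h⟩ := exists_singular_system (a • S + b • T) hn
  calc ∑ i : Fin n, (a • S + b • T).singularValues i
      = a * ∑ i, ⟪S (v i), u i⟫ + b * ∑ i, ⟪T (v i), u i⟫ := by
        simp_rw [← h, Finset.mul_sum, ← Finset.sum_add_distrib]
        simp [inner_add_left, inner_smul_left]
    _ ≤ _ := add_le_add
        (mul_le_mul_of_nonneg_left (sum_inner_le_sum_singularValues S hn v hu) ha)
        (mul_le_mul_of_nonneg_left (sum_inner_le_sum_singularValues T hn v hu) hb)

variable {N : ℕ}

theorem nuclearNorm_nonneg (A : Matrix (Fin N) (Fin N) ℝ) : 0 ≤ nuclearNorm A :=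
  Finset.sum_nonneg fun i _ => LinearMap.singularValues_nonneg _ i

theorem nuclearNorm_convex (A B : Matrix (Fin N) (Fin N) ℝ) {a b : ℝ} (ha : 0 ≤ a) (hb : 0 ≤ b) :
    nuclearNorm (a • A + b • B) ≤ a * nuclearNorm A + b * nuclearNorm B := by
  unfold nuclearNorm
  rw [map_add, map_smul, map_smul]
  exact sum_singularValues_convex _ _ finrank_euclideanSpace_fin ha hb

/-- The nuclear norm dominates every entry, because matrix units have operator norm one. -/
theorem abs_apply_le_nuclearNorm (A : Matrix (Fin N) (Fin N) ℝ) (i j : Fin N) :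
    |A i j| ≤ nuclearNorm A := by
  have key : ∀ c : ℝ, |c| ≤ 1 → c * A i j ≤ nuclearNorm A := by
    intro c hc
    have hu : IsBesselFamily (fun k : Fin N =>
        if k = j then c • EuclideanSpace.single i (1 : ℝ) else 0) := by
      intro x
      rw [Finset.sum_eq_single j (by intro k _ hk; simp [hk]) (by simp)]
      have h1 : |x i| ≤ ‖x‖ := by simpa using PiLp.norm_apply_le x i
      simp only [if_true, inner_smul_left, EuclideanSpace.inner_single_left]
      have : (c * x i) ^ 2 ≤ ‖x‖ ^ 2 := by
        rw [sq_le_sq, abs_mul, abs_norm]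
        calc |c| * |x i| ≤ 1 * ‖x‖ := by gcongr
          _ = ‖x‖ := one_mul _
      simpa using this
    have h := sum_inner_le_sum_singularValues (Matrix.toEuclideanLin A) finrank_euclideanSpace_fin
      (EuclideanSpace.basisFun (Fin N) ℝ) hu
    rw [Finset.sum_eq_single j (by intro k _ hk; simp [hk]) (by simp)] at h
    simpa [inner_smul_right, EuclideanSpace.inner_single_right, nuclearNorm] using h
  have h1 := key 1 (by simp)
  have h2 := key (-1) (by simp)
  exact abs_le.2 ⟨by linarith, by linarith⟩

end NuclearNorm

/-! ### Saddle points and Lagrange multipliers -/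

section LinearizedALM

open scoped RealInnerProductSpace

variable {E F : Type*} [NormedAddCommGroup E] [InnerProductSpace ℝ E]
  [NormedAddCommGroup F] [InnerProductSpace ℝ F]

/-- The objective `x ↦ ½ ⟪x, T x⟫ + g x` with smooth quadratic part given by `T`. -/
noncomputable def quadObj (g : E → ℝ) (T : E →L[ℝ] E) (x : E) : ℝ :=
  1 / 2 * ⟪x, T x⟫ + g x

/-- `(x, y)` is a saddle point of the Lagrangian of `min quadObj g T x` subject to `A x = b`:
`x` is feasible and minimizes the Lagrangian with multiplier `y`. -/
def IsSaddle (g : E → ℝ) (T : E →L[ℝ] E) (A : E →L[ℝ] F) (b : F) (x : E) (y : F) : Prop :=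
  A x = b ∧ ∀ z, quadObj g T x ≤ quadObj g T z + ⟪y, A z - b⟫

theorem continuous_quadObj {g : E → ℝ} (hg : Continuous g) (T : E →L[ℝ] E) :
    Continuous (quadObj g T) := by
  unfold quadObj
  fun_prop

/-- The quadratic part lies above its linearization. -/
theorem quadratic_ge_linearization {T : E →L[ℝ] E} (hT : (T : E →ₗ[ℝ] E).IsSymmetric)
    (hT0 : ∀ x, 0 ≤ ⟪x, T x⟫) (x z : E) :
    1 / 2 * ⟪x, T x⟫ + ⟪T x, z - x⟫ ≤ 1 / 2 * ⟪z, T z⟫ := by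
  have h := hT0 (z - x)
  have hs : ⟪T x, z⟫ = ⟪x, T z⟫ := hT x z
  simp only [map_sub, inner_sub_left, inner_sub_right] at h ⊢
  rw [real_inner_comm (T x) z, real_inner_comm x (T x)] at *
  linarith

theorem convexOn_quadObj {g : E → ℝ} (hg : ConvexOn ℝ Set.univ g) {T : E →L[ℝ] E}
    (hT : (T : E →ₗ[ℝ] E).IsSymmetric) (hT0 : ∀ x, 0 ≤ ⟪x, T x⟫) :
    ConvexOn ℝ Set.univ (quadObj g T) := by
  refine ConvexOn.add ⟨convex_univ, fun x _ z _ a c ha hc hac => ?_⟩ hg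
  have hx := quadratic_ge_linearization hT hT0 (a • x + c • z) x
  have hz := quadratic_ge_linearization hT hT0 (a • x + c • z) z
  have hx' := mul_le_mul_of_nonneg_left hx ha
  have hz' := mul_le_mul_of_nonneg_left hz hc
  have h0 : a * ⟪T (a • x + c • z), x - (a • x + c • z)⟫
      + c * ⟪T (a • x + c • z), z - (a • x + c • z)⟫ = 0 := by
    rw [← real_inner_smul_right, ← real_inner_smul_right, ← inner_add_right]
    have : a • (x - (a • x + c • z)) + c • (z - (a • x + c • z)) = 0 := by
      have hc' : c = 1 - a := by linarith
      subst hc'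
      module
    rw [this, inner_zero_right]
  simp only [smul_eq_mul]
  obtain rfl : c = 1 - a := by linarith
  nlinarith

/-- A functional vanishing on `ker A` is a multiplier composed with `A`. -/
theorem exists_inner_eq_of_ker_le [FiniteDimensional ℝ F] {A : E →L[ℝ] F} {l : E →ₗ[ℝ] ℝ}
    (h : ∀ x, A x = 0 → l x = 0) :
    ∃ y : F, ∀ x, l x = ⟪y, A x⟫ := by
  have hmem : l ∈ LinearMap.range (A : E →ₗ[ℝ] F).dualMap := by
    rw [LinearMap.range_dualMap_eq_dualAnnihilator_ker, Submodule.mem_dualAnnihilator]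
    intro x hx
    exact h x hx
  obtain ⟨φ, rfl⟩ := hmem
  refine ⟨(InnerProductSpace.toDual ℝ F).symm (LinearMap.toContinuousLinearMap φ), fun x => ?_⟩
  simp

/-- Lagrange multipliers exist for a convex problem under affine constraints: separate the open
strict epigraph of the objective from the feasible set at the optimal level. -/
theorem exists_isSaddle [FiniteDimensional ℝ F] {g : E → ℝ} {T : E →L[ℝ] E} {A : E →L[ℝ] F} {b : F}
    (hconv : ConvexOn ℝ Set.univ (quadObj g T)) (hcont : Continuous (quadObj g T))
    {x : E} (hx : A x = b) (hmin : ∀ z, A z = b → quadObj g T x ≤ quadObj g T z) :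
    ∃ y, IsSaddle g T A b x y := by
  set o := quadObj g T with ho
  obtain ⟨f, u, hf1, hf2⟩ := geometric_hahn_banach_open (E := E × ℝ)
    (s := {q : E × ℝ | q.1 ∈ Set.univ ∧ o q.1 < q.2}) (t := {q : E × ℝ | A q.1 = b ∧ q.2 = o x})
    hconv.convex_strict_epigraph
    (by
      simp only [Set.mem_univ, true_and]
      exact isOpen_lt (hcont.comp continuous_fst) continuous_snd)
    (by
      rintro ⟨p, s⟩ ⟨hp, hs⟩ ⟨q, t⟩ ⟨hq, ht⟩ a c - - hac
      refine ⟨?_, ?_⟩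
      · simp only [Prod.smul_mk, Prod.mk_add_mk, map_add, map_smul] at hp hq ⊢
        rw [hp, hq, ← add_smul, hac, one_smul]
      · simp only [Prod.smul_mk, Prod.mk_add_mk, smul_eq_mul] at hs ht ⊢
        rw [hs, ht, ← add_mul, hac, one_mul])
    (by
      rw [Set.disjoint_left]
      rintro ⟨p, s⟩ ⟨-, hp⟩ ⟨hq, hs⟩
      simp only at hp hq hs
      have := hmin p hq
      linarith)
  set l : E →ₗ[ℝ] ℝ := (f : E × ℝ →ₗ[ℝ] ℝ) ∘ₗ LinearMap.inl ℝ E ℝ with hl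
  set c : ℝ := f (0, 1) with hc
  have hfs : ∀ p s, f (p, s) = l p + c * s := by
    intro p s
    have : ((p, s) : E × ℝ) = (p, 0) + s • (0, 1) := by simp
    rw [this, map_add, map_smul]
    simp [hl, hc, mul_comm]
  have hup : u ≤ l x + c * o x := by
    rw [← hfs]; exact hf2 _ ⟨hx, rfl⟩
  have hlow : ∀ z t, o z < t → l z + c * t < u := by
    intro z t h
    rw [← hfs]; exact hf1 _ ⟨Set.mem_univ _, h⟩
  have hcneg : c < 0 := by
    have := hlow x (o x + 1) (by linarith)
    nlinarith
  have hker : ∀ d, A d = 0 → l d = 0 := by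
    intro d hd
    have hb : ∀ s : ℝ, u ≤ l x + s * l d + c * o x := by
      intro s
      have := hf2 (x + s • d, o x) ⟨by simp [hx, hd], rfl⟩
      rw [hfs] at this
      simpa using this
    by_contra hne
    have := hb ((u - l x - c * o x - 1) / l d)
    rw [div_mul_cancel₀ _ hne] at this
    linarith
  obtain ⟨y, hy⟩ := exists_inner_eq_of_ker_le hker
  refine ⟨c⁻¹ • y, hx, fun z => ?_⟩
  have hz : l z + c * o z ≤ l x + c * o x := by
    refine le_of_forall_pos_lt_add fun ε hε => ?_
    have h1 := hlow z (o z + ε / (-c)) (by have := div_pos hε (neg_pos.2 hcneg); linarith)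
    have h2 : c * (o z + ε / (-c)) = c * o z - ε := by
      have := hcneg.ne
      field_simp
      ring
    rw [h2] at h1
    linarith
  have h3 : ⟪c⁻¹ • y, A z - b⟫ = c⁻¹ * (l z - l x) := by
    rw [hy, hy, ← inner_sub_right, hx, inner_smul_left]
    simp
  rw [h3]
  have h4 : 0 ≤ c⁻¹ * (l z - l x + c * (o z - o x)) :=
    mul_nonneg_of_nonpos_of_nonpos (inv_nonpos.2 hcneg.le) (by linarith)
  have h5 : c⁻¹ * (l z - l x + c * (o z - o x)) = c⁻¹ * (l z - l x) + (o z - o x) := by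
    have := hcneg.ne
    field_simp
  linarith

/-! ### Energy decrease along the iteration -/

/-- The linearized augmented Lagrangian iteration for `min quadObj g T x` subject to `A x = b`.
The proximal step is recorded through its variational inequality. -/
structure IsLinearizedALM (g : E → ℝ) (T : E →L[ℝ] E) (A : E →L[ℝ] F) (b : F) (η : ℝ)
    (β : ℕ → ℝ) (w : ℕ → E) (y : ℕ → F) : Prop where
  prox : ∀ k z, g (w (k + 1)) - ⟪T (w k), z - w (k + 1)⟫
    - ⟪y k + β k • (A (w k) - b), A (z - w (k + 1))⟫
    - η * β k * ⟪w (k + 1) - w k, z - w (k + 1)⟫ ≤ g z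
  dual : ∀ k, y (k + 1) = y k + β k • (A (w (k + 1)) - b)

/-- The Lyapunov function of the iteration: `η ‖w - x‖² + ‖y - y'‖² / β²`. -/
noncomputable def energy (η : ℝ) (x : E) (y' : F) (β : ℝ) (w : E) (y : F) : ℝ :=
  η * ‖w - x‖ ^ 2 + ‖β⁻¹ • (y - y')‖ ^ 2

/-- The excess of the Lagrangian at `z` over its minimum, for a saddle point `(x, y)`. -/
noncomputable def lagrangianGap (g : E → ℝ) (T : E →L[ℝ] E) (A : E →L[ℝ] F) (b : F)
    (x : E) (y : F) (z : E) : ℝ :=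
  quadObj g T z + ⟪y, A z - b⟫ - quadObj g T x

/-- One step of the iteration decreases the energy.  Testing the proximal inequality at the saddle
point and the saddle inequality at the new iterate, all cross terms polarize into differences of
squares; the quadratic part `T` costs only `‖Δ‖_T² / β`. -/
theorem energy_step {g : E → ℝ} {T : E →L[ℝ] E} {A : E →L[ℝ] F} {b : F} {η : ℝ}
    (hT : (T : E →ₗ[ℝ] E).IsSymmetric) (hT0 : ∀ x, 0 ≤ ⟪x, T x⟫)
    {β : ℕ → ℝ} {w : ℕ → E} {y : ℕ → F} (h : IsLinearizedALM g T A b η β w y)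
    {x : E} {y' : F} (hs : IsSaddle g T A b x y') {k : ℕ} (hβ : 0 < β k)
    (hβ' : β k ≤ β (k + 1)) {c : ℝ}
    (hc : ∀ d, ‖A d‖ ^ 2 + (β k)⁻¹ * ⟪d, T d⟫ + c * ‖d‖ ^ 2 ≤ η * ‖d‖ ^ 2) :
    energy η x y' (β (k + 1)) (w (k + 1)) (y (k + 1)) + ‖A (w k) - b‖ ^ 2
      + c * ‖w (k + 1) - w k‖ ^ 2
      + 2 * ((β k)⁻¹ * lagrangianGap g T A b x y' (w (k + 1)))
      ≤ energy η x y' (β k) (w k) (y k) := by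
  have hp := h.prox k x
  have hd := h.dual k
  set D := w (k + 1) - w k with hD
  set e := w k - x with he
  set r := A (w k) - b with hr
  set q := y k - y' with hq
  set B := β k with hB
  have hw1 : w (k + 1) = x + (e + D) := by rw [he, hD]; abel
  have hw0 : w k = x + e := by rw [he]; abel
  have hr' : r = A e := by rw [hr, he, map_sub, hs.1]
  have hr1 : A (w (k + 1)) - b = r + A D := by rw [hw1, hr', ← hs.1]; simp
  have hq1 : y (k + 1) - y' = q + B • (r + A D) := by rw [hd, hr1, hq]; abel
  have hyk : y k = y' + q := by rw [hq]; abel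
  have hxw : x - w (k + 1) = -(e + D) := by rw [hw1]; abel
  have hcD := hc D
  -- the dual term only shrinks when the penalty grows
  have hmono : ‖(β (k + 1))⁻¹ • (q + B • (r + A D))‖ ^ 2
      ≤ ‖B⁻¹ • (q + B • (r + A D))‖ ^ 2 := by
    rw [norm_smul, norm_smul]
    have h1 : ‖(β (k + 1))⁻¹‖ ≤ ‖B⁻¹‖ := by
      rw [Real.norm_of_nonneg (inv_nonneg.2 hβ.le),
        Real.norm_of_nonneg (inv_nonneg.2 (hβ.le.trans hβ'))]
      exact inv_anti₀ hβ hβ'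
    gcongr
  have hexp : ‖B⁻¹ • (q + B • (r + A D))‖ ^ 2
      = ‖B⁻¹ • q‖ ^ 2 + 2 * (B⁻¹ * ⟪q, r + A D⟫) + ‖r + A D‖ ^ 2 := by
    have : B⁻¹ • (q + B • (r + A D)) = B⁻¹ • q + (r + A D) := by
      rw [smul_add, smul_smul, inv_mul_cancel₀ hβ.ne', one_smul]
    rw [this, norm_add_sq_real, inner_smul_left]
    simp
  have hexpe : ‖e + D‖ ^ 2 = ‖e‖ ^ 2 + 2 * ⟪e, D⟫ + ‖D‖ ^ 2 := norm_add_sq_real _ _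
  have hexpr : ‖r + A D‖ ^ 2 = ‖r‖ ^ 2 + 2 * ⟪r, A D⟫ + ‖A D‖ ^ 2 := norm_add_sq_real _ _
  have hTe := hT0 e
  have sym : ∀ p q : E, ⟪T p, q⟫ = ⟪p, T q⟫ := fun p q => hT p q
  have hgap : lagrangianGap g T A b x y' (w (k + 1)) =
      1 / 2 * ⟪x + (e + D), T (x + (e + D))⟫ + g (w (k + 1)) + ⟪y', r + A D⟫
        - (1 / 2 * ⟪x, T x⟫ + g x) := by
    rw [lagrangianGap, quadObj, quadObj, hr1, ← hw1]
  rw [hxw, hw0, hyk] at hp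
  have hAe : A (-(e + D)) = -(r + A D) := by rw [hr', map_neg, map_add]
  rw [hAe] at hp
  -- the main inequality before division by the penalty
  have hmain : lagrangianGap g T A b x y' (w (k + 1)) + ⟪q, r + A D⟫
      + B * ⟪r, r + A D⟫ + η * B * ⟪D, e + D⟫ + 1 / 2 * ⟪e, T e⟫ ≤ 1 / 2 * ⟪D, T D⟫ := by
    rw [hgap]
    simp only [inner_neg_right, map_add, inner_add_left, inner_add_right, inner_smul_left,
      sym, RCLike.conj_to_real] at hp ⊢
    rw [← sym e x, ← sym D x, ← sym D e, real_inner_comm x (T e), real_inner_comm x (T D),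
      real_inner_comm e (T D)]
    linarith
  have hdiv : B⁻¹ * lagrangianGap g T A b x y' (w (k + 1)) + B⁻¹ * ⟪q, r + A D⟫
      + ⟪r, r + A D⟫ + η * ⟪D, e + D⟫ ≤ 1 / 2 * (B⁻¹ * ⟪D, T D⟫) := by
    have h1 := mul_le_mul_of_nonneg_left hmain (inv_nonneg.2 hβ.le)
    have h2 : B⁻¹ * (lagrangianGap g T A b x y' (w (k + 1)) + ⟪q, r + A D⟫
      + B * ⟪r, r + A D⟫ + η * B * ⟪D, e + D⟫ + 1 / 2 * ⟪e, T e⟫)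
      = B⁻¹ * lagrangianGap g T A b x y' (w (k + 1)) + B⁻¹ * ⟪q, r + A D⟫
      + ⟪r, r + A D⟫ + η * ⟪D, e + D⟫ + B⁻¹ * (1 / 2 * ⟪e, T e⟫) := by
      field_simp
    have h3 : 0 ≤ B⁻¹ * (1 / 2 * ⟪e, T e⟫) := by positivity
    linarith
  rw [inner_add_right r, inner_add_right D, real_inner_self_eq_norm_sq, real_inner_self_eq_norm_sq,
    real_inner_comm e D] at hdiv
  unfold energy
  have hwx : w (k + 1) - x = e + D := by rw [hw1]; abel
  rw [hwx, hq1]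
  rw [hexp, hexpr] at hmono
  rw [hexpe]
  linarith

/-! ### Convergence of the iteration in Euclidean spaces -/

theorem summable_of_eventual_decrease {e p : ℕ → ℝ} {K : ℕ} (he : ∀ k, 0 ≤ e k)
    (hp : ∀ k, 0 ≤ p k) (h : ∀ k, K ≤ k → e (k + 1) + p k ≤ e k) : Summable p := by
  rw [← summable_nat_add_iff K]
  refine summable_of_sum_range_le (c := e K) (fun n => hp _) fun n => ?_
  have : ∑ i ∈ Finset.range n, p (i + K) ≤ e K - e (n + K) := by
    induction n with
    | zero => simp
    | succ n ih =>
      rw [Finset.sum_range_succ]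
      have := h (n + K) (by omega)
      rw [show n + 1 + K = n + K + 1 by ring]
      linarith
  linarith [he (n + K)]

theorem le_of_eventual_decrease {e : ℕ → ℝ} {K : ℕ} (h : ∀ k, K ≤ k → e (k + 1) ≤ e k)
    {m n : ℕ} (hm : K ≤ m) (hmn : m ≤ n) : e n ≤ e m := by
  induction n, hmn using Nat.le_induction with
  | base => exact le_rfl
  | succ n hn ih => exact (h n (hm.trans hn)).trans ih

/-- An eventually antitone nonnegative sequence with a subsequence tending to zero tends to zero. -/
theorem tendsto_zero_of_eventual_decrease {e : ℕ → ℝ} {K : ℕ} (he : ∀ k, 0 ≤ e k)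
    (h : ∀ k, K ≤ k → e (k + 1) ≤ e k) {θ : ℕ → ℕ} (hθ : Tendsto θ atTop atTop)
    (hlim : Tendsto (fun n => e (θ n)) atTop (𝓝 0)) : Tendsto e atTop (𝓝 0) := by
  refine tendsto_order.2 ⟨fun a ha => Eventually.of_forall fun k => ha.trans_le (he k),
    fun a ha => ?_⟩
  obtain ⟨n, hn, hKn⟩ := ((hlim.eventually (gt_mem_nhds ha)).and
    (hθ.eventually_ge_atTop K)).exists
  filter_upwards [eventually_ge_atTop (θ n)] with k hk
  exact (le_of_eventual_decrease h hKn hk).trans_lt hn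

/-- If `∑ a k = ∞` but `∑ a k * G k < ∞`, then `G` is small infinitely often. -/
theorem frequently_lt_of_summable_mul {a G : ℕ → ℝ} (ha : ∀ k, 0 ≤ a k)
    (hdiv : Tendsto (fun n => ∑ k ∈ Finset.range n, a k) atTop atTop)
    (hs : Summable fun k => a k * G k) {ε : ℝ} (hε : 0 < ε) : ∃ᶠ k in atTop, G k < ε := by
  intro hev
  refine (not_summable_iff_tendsto_nat_atTop_of_nonneg ha).2 hdiv ?_
  refine Summable.of_norm_bounded_eventually_nat (hs.mul_left ε⁻¹) ?_
  filter_upwards [hev] with k hk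
  rw [Real.norm_of_nonneg (ha k), inv_mul_eq_div, le_div_iff₀ hε]
  exact mul_le_mul_of_nonneg_left (not_lt.1 hk) (ha k)

omit [InnerProductSpace ℝ E] in
theorem energy_nonneg {η : ℝ} (hη : 0 ≤ η) (x : E) (y' : F) (β : ℝ) (w : E) (y : F) :
    0 ≤ energy η x y' β w y := by
  unfold energy
  positivity

theorem IsSaddle.lagrangianGap_nonneg {g : E → ℝ} {T : E →L[ℝ] E} {A : E →L[ℝ] F} {b : F}
    {x : E} {y : F} (h : IsSaddle g T A b x y) (z : E) : 0 ≤ lagrangianGap g T A b x y z :=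
  sub_nonneg.2 (h.2 z)

theorem IsSaddle.minimizes {g : E → ℝ} {T : E →L[ℝ] E} {A : E →L[ℝ] F} {b : F}
    {x : E} {y : F} (h : IsSaddle g T A b x y) {z : E} (hz : A z = b) :
    quadObj g T x ≤ quadObj g T z := by
  simpa [hz] using h.2 z

/-- The dual variables stay in the range of `A` when started at zero. -/
theorem IsLinearizedALM.dual_mem_range {g : E → ℝ} {T : E →L[ℝ] E} {A : E →L[ℝ] F} {b : F}
    {η : ℝ} {β : ℕ → ℝ} {w : ℕ → E} {y : ℕ → F} (h : IsLinearizedALM g T A b η β w y)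
    (hy0 : y 0 = 0) {x : E} (hx : A x = b) (k : ℕ) :
    y k ∈ LinearMap.range (A : E →ₗ[ℝ] F) := by
  induction k with
  | zero => rw [hy0]; exact Submodule.zero_mem _
  | succ k ih =>
    rw [h.dual]
    refine Submodule.add_mem _ ih (Submodule.smul_mem _ _ ⟨w (k + 1) - x, ?_⟩)
    simp [hx]

/-- The proximal inequality divided by the penalty, which keeps all terms bounded. -/
theorem IsLinearizedALM.prox_div {g : E → ℝ} {T : E →L[ℝ] E} {A : E →L[ℝ] F} {b : F}
    {η : ℝ} {β : ℕ → ℝ} {w : ℕ → E} {y : ℕ → F} (h : IsLinearizedALM g T A b η β w y)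
    {k : ℕ} (hβ : 0 < β k) (z : E) :
    (β k)⁻¹ * (g (w (k + 1)) - ⟪T (w k), z - w (k + 1)⟫)
      - ⟪(β k)⁻¹ • y k + (A (w k) - b), A (z - w (k + 1))⟫
      - η * ⟪w (k + 1) - w k, z - w (k + 1)⟫ ≤ (β k)⁻¹ * g z := by
  have h1 := mul_le_mul_of_nonneg_left (h.prox k z) (inv_nonneg.2 hβ.le)
  refine le_of_eq_of_le ?_ h1
  rw [inner_add_left, inner_add_left, real_inner_smul_left, real_inner_smul_left]
  field_simp

/-- Limits of the divided proximal inequality yield a multiplier for the limit point, in both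
regimes `γ = lim β⁻¹ > 0` and `γ = 0`. In the second the scaled dual limit `ζ` is orthogonal to
the range of `A`, in which it lies, so the old multiplier serves. -/
theorem exists_isSaddle_of_limit {g : E → ℝ} {T : E →L[ℝ] E} {A : E →L[ℝ] F} {b : F}
    (hT : (T : E →ₗ[ℝ] E).IsSymmetric) (hT0 : ∀ x, 0 ≤ ⟪x, T x⟫)
    {x : E} {y : F} (hs : IsSaddle g T A b x y) {v : E} {ζ : F} {γ : ℝ} (hγ : 0 ≤ γ)
    (hv : A v = b) (hobj : quadObj g T v = quadObj g T x)
    (hζ : ζ ∈ LinearMap.range (A : E →ₗ[ℝ] F))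
    (hlim : ∀ z, γ * (g v - ⟪T v, z - v⟫) - ⟪ζ, A (z - v)⟫ ≤ γ * g z) :
    ∃ y', IsSaddle g T A b v y' ∧ ζ = γ • y' := by
  rcases hγ.eq_or_lt with rfl | hpos
  · refine ⟨y, ⟨hv, fun z => hobj ▸ hs.2 z⟩, ?_⟩
    obtain ⟨d, rfl⟩ := hζ
    have h := hlim (v - d)
    simp only [zero_mul, zero_sub, sub_sub_cancel_left, map_neg, inner_neg_right, neg_neg] at h
    have : (A : E →ₗ[ℝ] F) d = 0 := real_inner_self_nonpos.1 h
    simp [this]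
  · refine ⟨γ⁻¹ • ζ, ⟨hv, fun z => ?_⟩, by rw [smul_smul, mul_inv_cancel₀ hpos.ne', one_smul]⟩
    have h := mul_le_mul_of_nonneg_left (hlim z) (inv_nonneg.2 hγ)
    have hlin := quadratic_ge_linearization hT hT0 v z
    have h1 : ⟪γ⁻¹ • ζ, A z - b⟫ = γ⁻¹ * ⟪ζ, A (z - v)⟫ := by
      rw [real_inner_smul_left, map_sub, hv]
    rw [h1, quadObj, quadObj]
    rw [mul_sub, ← mul_assoc, ← mul_assoc, inv_mul_cancel₀ hpos.ne', one_mul, one_mul] at h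
    linarith

/-- Convergence of the linearized augmented Lagrangian iteration with growing penalties. -/
theorem IsLinearizedALM.tendsto_minimizer [FiniteDimensional ℝ E] [FiniteDimensional ℝ F]
    {g : E → ℝ} {T : E →L[ℝ] E} {A : E →L[ℝ] F} {b : F} {η : ℝ} {β : ℕ → ℝ} {w : ℕ → E}
    {y : ℕ → F} (h : IsLinearizedALM g T A b η β w y)
    (hg : ConvexOn ℝ Set.univ g) (hgc : Continuous g)
    (hT : (T : E →ₗ[ℝ] E).IsSymmetric) (hT0 : ∀ x, 0 ≤ ⟪x, T x⟫) (hη : 0 < η)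
    (hβ : ∀ k, 0 < β k) (hmono : Monotone β)
    (hdiv : Tendsto (fun n => ∑ k ∈ Finset.range n, (β k)⁻¹) atTop atTop)
    {c : ℝ} (hc0 : 0 < c)
    (hc : ∀ᶠ k in atTop, ∀ d, ‖A d‖ ^ 2 + (β k)⁻¹ * ⟪d, T d⟫ + c * ‖d‖ ^ 2 ≤ η * ‖d‖ ^ 2)
    (hy0 : y 0 = 0) {x : E} (hx : A x = b)
    (hmin : ∀ z, A z = b → quadObj g T x ≤ quadObj g T z) :
    ∃ v, (A v = b ∧ ∀ z, A z = b → quadObj g T v ≤ quadObj g T z) ∧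
      Tendsto w atTop (𝓝 v) := by
  have hoc : Continuous (quadObj g T) := continuous_quadObj hgc T
  obtain ⟨y', hs⟩ := exists_isSaddle (convexOn_quadObj hg hT hT0) hoc hx hmin
  obtain ⟨K, hK⟩ := eventually_atTop.1 hc
  have hstep : ∀ {x : E} {y' : F}, IsSaddle g T A b x y' → ∀ k, K ≤ k →
      energy η x y' (β (k + 1)) (w (k + 1)) (y (k + 1)) + (‖A (w k) - b‖ ^ 2
        + c * ‖w (k + 1) - w k‖ ^ 2
        + 2 * ((β k)⁻¹ * lagrangianGap g T A b x y' (w (k + 1))))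
        ≤ energy η x y' (β k) (w k) (y k) := by
    intro x y' hs k hk
    have := energy_step hT hT0 h hs (hβ k) (hmono k.le_succ) (hK k hk)
    linarith
  set G : ℕ → ℝ := fun k => lagrangianGap g T A b x y' (w (k + 1)) with hG
  have hG0 : ∀ k, 0 ≤ G k := fun k => hs.lagrangianGap_nonneg _
  have hβi : ∀ k, 0 ≤ (β k)⁻¹ := fun k => inv_nonneg.2 (hβ k).le
  set e : ℕ → ℝ := fun k => energy η x y' (β k) (w k) (y k) with he
  have he0 : ∀ k, 0 ≤ e k := fun k => energy_nonneg hη.le _ _ _ _ _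
  have hγG0 : ∀ k, 0 ≤ (β k)⁻¹ * G k := fun k => mul_nonneg (hβi k) (hG0 k)
  have hp0 : ∀ k, 0 ≤ ‖A (w k) - b‖ ^ 2 + c * ‖w (k + 1) - w k‖ ^ 2
      + 2 * ((β k)⁻¹ * G k) := by
    intro k
    have := hγG0 k
    positivity
  have hsum := summable_of_eventual_decrease he0 hp0 (hstep hs)
  -- residuals and increments vanish, and the gaps are summable with weights `1 / β`
  have hr : Tendsto (fun k => A (w k) - b) atTop (𝓝 0) := by
    rw [tendsto_zero_iff_norm_tendsto_zero]
    have : Tendsto (fun k => ‖A (w k) - b‖ ^ 2) atTop (𝓝 0) :=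
      squeeze_zero (fun _ => by positivity) (fun k => by
        have := hγG0 k
        have : 0 ≤ c * ‖w (k + 1) - w k‖ ^ 2 := by positivity
        linarith) hsum.tendsto_atTop_zero
    simpa using this.sqrt
  have hD : Tendsto (fun k => w (k + 1) - w k) atTop (𝓝 0) := by
    rw [tendsto_zero_iff_norm_tendsto_zero]
    have hlim := hsum.tendsto_atTop_zero.const_mul c⁻¹
    rw [mul_zero] at hlim
    have : Tendsto (fun k => ‖w (k + 1) - w k‖ ^ 2) atTop (𝓝 0) :=
      squeeze_zero (fun _ => by positivity) (fun k => by
        have := hγG0 k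
        have : 0 ≤ ‖A (w k) - b‖ ^ 2 := by positivity
        rw [inv_mul_eq_div, le_div_iff₀ hc0]
        linarith) hlim
    simpa using this.sqrt
  have hGsum : Summable fun k => (β k)⁻¹ * G k :=
    Summable.of_nonneg_of_le hγG0 (fun k => by
      have := hγG0 k
      have : 0 ≤ ‖A (w k) - b‖ ^ 2 + c * ‖w (k + 1) - w k‖ ^ 2 := by positivity
      linarith) hsum
  obtain ⟨φ, hφ, hφG⟩ := extraction_forall_of_frequently (P := fun n k => G k < 1 / ((n : ℝ) + 1))
    fun n => frequently_lt_of_summable_mul hβi hdiv hGsum (by positivity)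
  -- compactness, for the iterates and the scaled dual variables
  have hbdd : ∀ k, K ≤ k → (w k, (β k)⁻¹ • (y k - y')) ∈
      Metric.closedBall x √(e K / η) ×ˢ Metric.closedBall (0 : F) √(e K) := by
    intro k hk
    have hle : e k ≤ e K := le_of_eventual_decrease
      (fun k hk => by have := hstep hs k hk; have := hp0 k; linarith) le_rfl hk
    simp only [he, energy] at hle
    have h1 : 0 ≤ η * ‖w k - x‖ ^ 2 := by positivity
    have h2 : 0 ≤ ‖(β k)⁻¹ • (y k - y')‖ ^ 2 := by positivity
    rw [Set.mem_prod, mem_closedBall_iff_norm, mem_closedBall_iff_norm, sub_zero]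
    constructor
    · refine Real.le_sqrt_of_sq_le ?_
      rw [le_div_iff₀ hη]
      simp only [he, energy]
      linarith
    · refine Real.le_sqrt_of_sq_le ?_
      simp only [he, energy]
      linarith
  obtain ⟨⟨v, ζ⟩, -, ψ, hψ, hlim⟩ := tendsto_subseq_of_frequently_bounded
    (Metric.isBounded_closedBall.prod Metric.isBounded_closedBall)
    (x := fun n => (w (φ n), (β (φ n))⁻¹ • (y (φ n) - y')))
    ((hφ.tendsto_atTop.eventually_ge_atTop K).mono fun n hn => hbdd _ hn).frequently
  set θ : ℕ → ℕ := fun n => φ (ψ n) with hθdef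
  have hθ : Tendsto θ atTop atTop := hφ.tendsto_atTop.comp hψ.tendsto_atTop
  have hw : Tendsto (fun n => w (θ n)) atTop (𝓝 v) := (continuous_fst.tendsto _).comp hlim
  have hζ : Tendsto (fun n => (β (θ n))⁻¹ • (y (θ n) - y')) atTop (𝓝 ζ) :=
    (continuous_snd.tendsto _).comp hlim
  have hw1 : Tendsto (fun n => w (θ n + 1)) atTop (𝓝 v) := by
    simpa using hw.add (hD.comp hθ)
  obtain ⟨γ, hγ⟩ : ∃ γ, Tendsto (fun k => (β k)⁻¹) atTop (𝓝 γ) :=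
    ⟨_, tendsto_atTop_ciInf (fun i j hij => inv_anti₀ (hβ i) (hmono hij))
      ⟨0, by rintro _ ⟨k, rfl⟩; exact hβi k⟩⟩
  have hγ0 : 0 ≤ γ := ge_of_tendsto' hγ hβi
  have hγθ : Tendsto (fun n => (β (θ n))⁻¹) atTop (𝓝 γ) := hγ.comp hθ
  have hz : Tendsto (fun n => (β (θ n))⁻¹ • y (θ n)) atTop (𝓝 (ζ + γ • y')) := by
    have := hζ.add (hγθ.smul_const y')
    refine this.congr fun n => ?_
    rw [← smul_add, sub_add_cancel]
  have hAv : A v = b := by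
    have h1 := ((A.continuous.tendsto v).comp hw).sub_const b
    exact sub_eq_zero.1 (tendsto_nhds_unique h1 (hr.comp hθ))
  have hobj : quadObj g T v = quadObj g T x := by
    have h1 : Tendsto (fun n => G (θ n)) atTop (𝓝 (lagrangianGap g T A b x y' v)) := by
      have : Continuous (lagrangianGap g T A b x y') := by
        unfold lagrangianGap
        fun_prop
      exact (this.tendsto v).comp hw1
    have h2 : Tendsto (fun n => G (θ n)) atTop (𝓝 0) :=
      squeeze_zero (fun n => hG0 _) (fun n => (hφG (ψ n)).le)
        (tendsto_one_div_add_atTop_nhds_zero_nat.comp hψ.tendsto_atTop)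
    have h3 := tendsto_nhds_unique h1 h2
    rw [lagrangianGap, hAv, sub_self, inner_zero_right] at h3
    linarith
  have hrange : ζ + γ • y' ∈ LinearMap.range (A : E →ₗ[ℝ] F) :=
    (Submodule.closed_of_finiteDimensional _).mem_of_tendsto hz
      (Eventually.of_forall fun n => Submodule.smul_mem _ _ (h.dual_mem_range hy0 hx _))
  have hproxlim : ∀ z, γ * (g v - ⟪T v, z - v⟫) - ⟪ζ + γ • y', A (z - v)⟫ ≤ γ * g z := by
    intro z
    have hzw : Tendsto (fun n => z - w (θ n + 1)) atTop (𝓝 (z - v)) := hw1.const_sub z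
    have h1 := (hγθ.mul (((hgc.tendsto v).comp hw1).sub
      (((T.continuous.tendsto v).comp hw).inner hzw))).sub
      ((hz.add (hr.comp hθ)).inner ((A.continuous.tendsto _).comp hzw))
    have h2 := h1.sub (((hD.comp hθ).inner hzw).const_mul η)
    have h3 := le_of_tendsto_of_tendsto' h2 (hγθ.mul_const (g z))
      fun n => h.prox_div (hβ (θ n)) z
    simpa using h3
  obtain ⟨y'', hs', hy''⟩ := exists_isSaddle_of_limit hT hT0 hs hγ0 hAv hobj hrange hproxlim
  refine ⟨v, ⟨hAv, fun z hz => hs'.minimizes hz⟩, ?_⟩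
  -- the energy relative to the new saddle point vanishes along the subsequence, hence everywhere
  have hev : Tendsto (fun k => energy η v y'' (β k) (w k) (y k)) atTop (𝓝 0) := by
    refine tendsto_zero_of_eventual_decrease (fun k => energy_nonneg hη.le _ _ _ _ _)
      (fun k hk => ?_) hθ ?_ (K := K)
    · have h1 := hstep hs' k hk
      have h2 := mul_nonneg (hβi k) (hs'.lagrangianGap_nonneg (w (k + 1)))
      have h3 : 0 ≤ ‖A (w k) - b‖ ^ 2 + c * ‖w (k + 1) - w k‖ ^ 2 := by positivity
      linarith
    · have h1 := (((hw.sub_const v).norm.pow 2).const_mul η).add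
        ((hz.sub (hγθ.smul_const y'')).norm.pow 2)
      rw [hy'', sub_self, sub_self, norm_zero, norm_zero] at h1
      simp only [energy, smul_sub]
      simpa using h1
  rw [tendsto_iff_norm_sub_tendsto_zero]
  have hev' := hev.const_mul η⁻¹
  rw [mul_zero] at hev'
  have hsq : Tendsto (fun k => ‖w k - v‖ ^ 2) atTop (𝓝 0) :=
    squeeze_zero (fun _ => by positivity) (fun k => by
      have : 0 ≤ ‖(β k)⁻¹ • (y k - y'')‖ ^ 2 := by positivity
      rw [inv_mul_eq_div, le_div_iff₀ hη]
      simp only [energy]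
      linarith) hev'
  simpa using hsq.sqrt

end LinearizedALM

/-! ### Matrices as vectors -/

section Vectorization

open scoped RealInnerProductSpace

variable {N : ℕ}

/-- The entries of a matrix as a vector, an isometry for the Frobenius norm. -/
def vec : Matrix (Fin N) (Fin N) ℝ ≃ₗ[ℝ] EuclideanSpace ℝ (Fin N × Fin N) where
  toFun W := WithLp.toLp 2 fun q => W q.1 q.2
  invFun x := Matrix.of fun i j => x (i, j)
  map_add' _ _ := rfl
  map_smul' _ _ := rfl
  left_inv _ := rfl
  right_inv _ := rfl

theorem inner_vec (V W : Matrix (Fin N) (Fin N) ℝ) : ⟪vec V, vec W⟫ = ∑ i, V i ⬝ᵥ W i := by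
  rw [PiLp.inner_apply, Fintype.sum_prod_type]
  exact Finset.sum_congr rfl fun i _ => Finset.sum_congr rfl fun j _ => mul_comm _ _

theorem norm_vec_sq (W : Matrix (Fin N) (Fin N) ℝ) : ‖vec W‖ ^ 2 = frobSq W := by
  rw [← real_inner_self_eq_norm_sq, inner_vec]
  simp [frobSq, dotProduct, sq]

theorem continuous_vec_symm :
    Continuous (vec.symm : EuclideanSpace ℝ (Fin N × Fin N) → Matrix (Fin N) (Fin N) ℝ) :=
  LinearMap.continuous_of_finiteDimensional
    (vec.symm : EuclideanSpace ℝ (Fin N × Fin N) ≃ₗ[ℝ] Matrix (Fin N) (Fin N) ℝ).toLinearMap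

theorem projOn_add (Ω : Set (Fin N × Fin N)) (V W : Matrix (Fin N) (Fin N) ℝ) :
    projOn Ω (V + W) = projOn Ω V + projOn Ω W := by
  ext i j
  by_cases h : (i, j) ∈ Ω <;> simp [projOn, h]

theorem projOn_smul (Ω : Set (Fin N × Fin N)) (c : ℝ) (W : Matrix (Fin N) (Fin N) ℝ) :
    projOn Ω (c • W) = c • projOn Ω W := by
  ext i j
  by_cases h : (i, j) ∈ Ω <;> simp [projOn, h]

theorem inner_projOn_left (Ω : Set (Fin N × Fin N)) (V W : Matrix (Fin N) (Fin N) ℝ) :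
    ⟪vec (projOn Ω V), vec W⟫ = ⟪vec (projOn Ω V), vec (projOn Ω W)⟫ := by
  rw [inner_vec, inner_vec]
  refine Finset.sum_congr rfl fun i _ => Finset.sum_congr rfl fun j _ => ?_
  by_cases h : (i, j) ∈ Ω <;> simp [projOn, h]

/-- The map `W ↦ W ⊙ B`, the gradient of the quadratic part of the objective. -/
noncomputable def rowMul (B : Fin N → Matrix (Fin N) (Fin N) ℝ) :
    EuclideanSpace ℝ (Fin N × Fin N) →L[ℝ] EuclideanSpace ℝ (Fin N × Fin N) :=
  LinearMap.toContinuousLinearMap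
    { toFun := fun x => vec (Matrix.of fun i => vec.symm x i ᵥ* B i)
      map_add' := fun x z => by
        rw [map_add, ← map_add vec]
        exact congrArg vec (funext fun i => Matrix.add_vecMul (B i) _ _)
      map_smul' := fun c x => by
        rw [map_smul, RingHom.id_apply, ← map_smul vec]
        exact congrArg vec (funext fun i => Matrix.smul_vecMul c _ (B i)) }

/-- Stacking of a vector and a matrix, such as the residuals of the two constraints or their
multipliers, into one vector of a Euclidean space. -/
def stack (y : Fin N → ℝ) (Y : Matrix (Fin N) (Fin N) ℝ) :
    EuclideanSpace ℝ (Fin N ⊕ Fin N × Fin N) :=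
  WithLp.toLp 2 (Sum.elim y fun q => Y q.1 q.2)

theorem stack_add (y z : Fin N → ℝ) (Y Z : Matrix (Fin N) (Fin N) ℝ) :
    stack y Y + stack z Z = stack (y + z) (Y + Z) := by
  ext (i | q) <;> rfl

theorem stack_sub (y z : Fin N → ℝ) (Y Z : Matrix (Fin N) (Fin N) ℝ) :
    stack y Y - stack z Z = stack (y - z) (Y - Z) := by
  ext (i | q) <;> rfl

theorem stack_smul (c : ℝ) (y : Fin N → ℝ) (Y : Matrix (Fin N) (Fin N) ℝ) :
    c • stack y Y = stack (c • y) (c • Y) := by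
  ext (i | q) <;> rfl

theorem stack_zero : stack (0 : Fin N → ℝ) 0 = 0 := by
  ext (i | q) <;> rfl

theorem inner_stack (y z : Fin N → ℝ) (Y Z : Matrix (Fin N) (Fin N) ℝ) :
    ⟪stack y Y, stack z Z⟫ = y ⬝ᵥ z + ⟪vec Y, vec Z⟫ := by
  rw [PiLp.inner_apply, Fintype.sum_sum_type, PiLp.inner_apply]
  exact congrArg₂ _ (Finset.sum_congr rfl fun i _ => mul_comm _ _) rfl

/-- The constraint map `W ↦ (W 1, P_Ω W)`. -/
noncomputable def constraintMap (Ω : Set (Fin N × Fin N)) :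
    EuclideanSpace ℝ (Fin N × Fin N) →L[ℝ]
      EuclideanSpace ℝ (Fin N ⊕ Fin N × Fin N) :=
  LinearMap.toContinuousLinearMap
    { toFun := fun x => stack (vec.symm x *ᵥ 1) (projOn Ω (vec.symm x))
      map_add' := fun x z => by
        rw [map_add, Matrix.add_mulVec, projOn_add, stack_add]
      map_smul' := fun c x => by
        rw [map_smul, Matrix.smul_mulVec, projOn_smul, RingHom.id_apply, stack_smul] }

theorem rowMul_vec (B : Fin N → Matrix (Fin N) (Fin N) ℝ) (W : Matrix (Fin N) (Fin N) ℝ) :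
    rowMul B (vec W) = vec (Matrix.of fun i => W i ᵥ* B i) := rfl

theorem constraintMap_vec (Ω : Set (Fin N × Fin N)) (W : Matrix (Fin N) (Fin N) ℝ) :
    constraintMap Ω (vec W) = stack (W *ᵥ 1) (projOn Ω W) := rfl

theorem constraintMap_eq_iff (Ω : Set (Fin N × Fin N)) (W : Matrix (Fin N) (Fin N) ℝ) :
    constraintMap Ω (vec W) = stack 1 0 ↔ IsFeasible Ω W := by
  rw [constraintMap_vec, IsFeasible]
  constructor
  · intro h
    exact ⟨funext fun i => congrArg (fun q => q (Sum.inl i)) h,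
      Matrix.ext fun i j => congrArg (fun q => q (Sum.inr (i, j))) h⟩
  · rintro ⟨h1, h2⟩
    rw [h1, h2]

theorem inner_rowMul (B : Fin N → Matrix (Fin N) (Fin N) ℝ) (V W : Matrix (Fin N) (Fin N) ℝ) :
    ⟪vec V, rowMul B (vec W)⟫ = ∑ i, W i ⬝ᵥ (B i *ᵥ V i) := by
  rw [rowMul_vec, real_inner_comm, inner_vec]
  exact Finset.sum_congr rfl fun i _ => (Matrix.dotProduct_mulVec (W i) (B i) (V i)).symm

theorem objective_eq_quadObj (B : Fin N → Matrix (Fin N) (Fin N) ℝ) (lam : ℝ)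
    (W : Matrix (Fin N) (Fin N) ℝ) : objective B lam W =
      quadObj (fun x => lam * nuclearNorm (vec.symm x)) (rowMul B) (vec W) := by
  rw [objective, quadObj, inner_rowMul, LinearEquiv.symm_apply_apply]

theorem isSymmetric_rowMul {B : Fin N → Matrix (Fin N) (Fin N) ℝ} (hB : ∀ i, (B i)ᵀ = B i) :
    (rowMul B : EuclideanSpace ℝ (Fin N × Fin N) →ₗ[ℝ] _).IsSymmetric := by
  intro x z
  obtain ⟨V, rfl⟩ := vec.surjective x
  obtain ⟨W, rfl⟩ := vec.surjective z
  change ⟪rowMul B (vec V), vec W⟫ = ⟪vec V, rowMul B (vec W)⟫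
  rw [real_inner_comm, inner_rowMul, inner_rowMul]
  refine Finset.sum_congr rfl fun i _ => ?_
  rw [Matrix.dotProduct_mulVec, dotProduct_comm, ← Matrix.mulVec_transpose, hB]

/-- `gradF` is the gradient of the smooth part of the augmented Lagrangian. -/
theorem inner_gradF (B : Fin N → Matrix (Fin N) (Fin N) ℝ) (Ω : Set (Fin N × Fin N)) (b : ℝ)
    (W : Matrix (Fin N) (Fin N) ℝ) (Y₁ : Fin N → ℝ) (Y₂ D : Matrix (Fin N) (Fin N) ℝ) :
    ⟪vec (gradF B Ω b W Y₁ Y₂), vec D⟫ = ⟪rowMul B (vec W), vec D⟫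
      + ⟪stack Y₁ (projOn Ω Y₂) + b • (constraintMap Ω (vec W) - stack 1 0),
          constraintMap Ω (vec D)⟫ := by
  have hrank : ∀ y : Fin N → ℝ, ⟪vec (Matrix.vecMulVec y 1), vec D⟫ = y ⬝ᵥ (D *ᵥ 1) := by
    intro y
    rw [inner_vec, dotProduct]
    refine Finset.sum_congr rfl fun i _ => ?_
    simp [Matrix.vecMulVec, dotProduct, Matrix.mulVec, Finset.mul_sum]
  rw [constraintMap_vec, constraintMap_vec, stack_sub, stack_smul, stack_add, inner_stack,
    sub_zero, gradF, rowMul_vec]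
  simp only [map_add, map_smul, inner_add_left, real_inner_smul_left, hrank, add_dotProduct,
    smul_dotProduct, smul_eq_mul]
  rw [inner_projOn_left Ω Y₂, inner_projOn_left Ω W]
  ring

end Vectorization

/-! ### Bounds on the quadratic term and on the constraint map -/

section Bounds

open scoped RealInnerProductSpace

variable {N d p : ℕ}

theorem gramB_transpose (H : Fin N → Fin N → Matrix (Fin d) (Fin p) ℝ) (i : Fin N) :
    (gramB H i)ᵀ = gramB H i := by
  ext j k
  simp only [gramB, Matrix.transpose_apply, Matrix.of_apply]
  rw [← Matrix.trace_transpose, Matrix.transpose_mul, Matrix.transpose_transpose]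

/-- `w B_i wᵀ` is the squared Frobenius norm of the tangent vector `∑ j, w_j H_{ij}`. -/
theorem gramB_quadratic_nonneg (H : Fin N → Fin N → Matrix (Fin d) (Fin p) ℝ) (i : Fin N)
    (w : Fin N → ℝ) : 0 ≤ w ⬝ᵥ (gramB H i *ᵥ w) := by
  have h : w ⬝ᵥ (gramB H i *ᵥ w) = ((∑ j, w j • H i j)ᵀ * ∑ k, w k • H i k).trace := by
    simp only [Matrix.transpose_sum, Matrix.sum_mul, Matrix.mul_sum, Matrix.trace_sum,
      Matrix.transpose_smul, Matrix.smul_mul, Matrix.mul_smul, Matrix.trace_smul, dotProduct,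
      Matrix.mulVec, gramB, Matrix.of_apply, Finset.mul_sum, smul_eq_mul]
    refine Finset.sum_congr rfl fun j _ => Finset.sum_congr rfl fun k _ => ?_
    rw [← Matrix.trace_transpose ((H i j)ᵀ * H i k), Matrix.transpose_mul,
      Matrix.transpose_transpose]
    ring
  rw [h, Matrix.trace]
  refine Finset.sum_nonneg fun a _ => ?_
  rw [Matrix.diag_apply, Matrix.mul_apply]
  exact Finset.sum_nonneg fun c _ => mul_self_nonneg _

theorem quadratic_le_specNorm (B : Matrix (Fin N) (Fin N) ℝ) (w : Fin N → ℝ) :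
    w ⬝ᵥ (B *ᵥ w) ≤ specNorm B * (w ⬝ᵥ w) := by
  set x : EuclideanSpace ℝ (Fin N) := WithLp.toLp 2 w with hx
  have h1 : w ⬝ᵥ (B *ᵥ w) = ⟪x, Matrix.toEuclideanCLM (n := Fin N) (𝕜 := ℝ) B x⟫ := by
    rw [hx, Matrix.toEuclideanCLM_toLp]
    simp [PiLp.inner_apply, dotProduct, mul_comm]
  have h2 : w ⬝ᵥ w = ‖x‖ * ‖x‖ := by
    rw [← real_inner_self_eq_norm_mul_norm, PiLp.inner_apply]
    rfl
  rw [h1, h2, specNorm, ← mul_assoc]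
  calc _ ≤ ‖x‖ * ‖Matrix.toEuclideanCLM (n := Fin N) (𝕜 := ℝ) B x‖ := real_inner_le_norm _ _
    _ ≤ ‖x‖ * (‖Matrix.toEuclideanCLM (n := Fin N) (𝕜 := ℝ) B‖ * ‖x‖) := by
        gcongr
        exact ContinuousLinearMap.le_opNorm _ _
    _ = _ := by ring

theorem specNorm_nonneg (B : Matrix (Fin N) (Fin N) ℝ) : 0 ≤ specNorm B := norm_nonneg _

theorem inner_rowMul_self_le (B : Fin N → Matrix (Fin N) (Fin N) ℝ)
    (x : EuclideanSpace ℝ (Fin N × Fin N)) :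
    ⟪x, rowMul B x⟫ ≤ (∑ i, specNorm (B i)) * ‖x‖ ^ 2 := by
  obtain ⟨W, rfl⟩ := vec.surjective x
  rw [inner_rowMul, ← real_inner_self_eq_norm_sq, inner_vec, Finset.mul_sum]
  refine Finset.sum_le_sum fun i _ => (quadratic_le_specNorm _ _).trans ?_
  have : specNorm (B i) ≤ ∑ i, specNorm (B i) :=
    Finset.single_le_sum (f := fun i => specNorm (B i)) (fun i _ => specNorm_nonneg _)
      (Finset.mem_univ i)
  exact mul_le_mul_of_nonneg_right this (Finset.sum_nonneg fun j _ => mul_self_nonneg _)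

/-- The gain over the trivial bound `N + 1` comes from the missing index `j₀`: the first term
reaches `N ∑ w_j²` only on constant vectors, for which the second term misses `w j₀ ≠ 0`. -/
theorem sq_sum_add_sum_erase_le (w : Fin N → ℝ) (j₀ : Fin N) :
    (∑ j, w j) ^ 2 + ∑ j ∈ Finset.univ.erase j₀, w j ^ 2
      ≤ (N + 1 - 1 / (2 * (N + 1))) * ∑ j, w j ^ 2 := by
  have hN : 1 ≤ N := Nat.one_le_iff_ne_zero.2 fun h => by subst h; exact j₀.elim0
  obtain ⟨n, rfl⟩ : ∃ n, N = n + 1 := ⟨N - 1, by omega⟩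
  rw [← Finset.add_sum_erase _ _ (Finset.mem_univ j₀),
    ← Finset.add_sum_erase _ (fun j => w j ^ 2) (Finset.mem_univ j₀)]
  have hcs : (∑ j ∈ Finset.univ.erase j₀, w j) ^ 2
      ≤ n * ∑ j ∈ Finset.univ.erase j₀, w j ^ 2 := by
    have := sq_sum_le_card_mul_sum_sq (s := Finset.univ.erase j₀) (f := w)
    simpa [Finset.card_erase_of_mem] using this
  set t := w j₀
  set s := ∑ j ∈ Finset.univ.erase j₀, w j
  set q := ∑ j ∈ Finset.univ.erase j₀, w j ^ 2
  have hq : 0 ≤ q := Finset.sum_nonneg fun j _ => sq_nonneg _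
  have hn : (0 : ℝ) ≤ n := Nat.cast_nonneg n
  push_cast
  -- Young's inequality with weight `n + 1/2`, strictly between `n` and `n + 1`
  have hyoung : 2 * t * s ≤ (n + 1 / 2) * t ^ 2 + s ^ 2 / (n + 1 / 2) := by
    have h : 0 ≤ ((n + 1 / 2) * t - s) ^ 2 / (n + 1 / 2 : ℝ) := by positivity
    have h' : ((n + 1 / 2) * t - s) ^ 2 / (n + 1 / 2 : ℝ)
        = (n + 1 / 2) * t ^ 2 + s ^ 2 / (n + 1 / 2) - 2 * t * s := by
      field_simp
      ring
    linarith
  have hs2 : s ^ 2 / (n + 1 / 2 : ℝ) ≤ n * q / (n + 1 / 2) := by gcongr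
  have hcoef : (n : ℝ) / (n + 1 / 2) ≤ 1 - 1 / (2 * (n + 1 + 1)) := by
    rw [div_le_iff₀ (by positivity)]
    have : (1 : ℝ) / (2 * (n + 1 + 1)) * (n + 1 / 2) ≤ 1 / 2 := by
      rw [div_mul_eq_mul_div, div_le_div_iff₀ (by positivity) (by positivity)]
      linarith
    linarith
  have hq2 : n * q / (n + 1 / 2 : ℝ) ≤ (1 - 1 / (2 * (n + 1 + 1))) * q := by
    rw [mul_div_right_comm]
    gcongr
  have heps : (1 : ℝ) / (2 * (n + 1 + 1)) ≤ 1 / 2 := by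
    gcongr
    linarith
  have ht : (1 : ℝ) / (2 * (n + 1 + 1)) * t ^ 2 ≤ 1 / 2 * t ^ 2 := by gcongr
  nlinarith

/-- Since every row has an entry outside `Ω`, the constraint map has norm strictly less than
`√(N + 1)`. -/
theorem norm_constraintMap_sq_le {nbr : Fin N → Set (Fin N)} (hnbr : ∀ i, ∃ j ∈ nbr i, j ≠ i)
    (x : EuclideanSpace ℝ (Fin N × Fin N)) :
    ‖constraintMap (Omega nbr) x‖ ^ 2 ≤ (N + 1 - 1 / (2 * (N + 1))) * ‖x‖ ^ 2 := by
  obtain ⟨W, rfl⟩ := vec.surjective x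
  rw [constraintMap_vec, ← real_inner_self_eq_norm_sq, inner_stack, inner_vec, norm_vec_sq,
    frobSq, dotProduct, ← Finset.sum_add_distrib, Finset.mul_sum]
  refine Finset.sum_le_sum fun i _ => ?_
  obtain ⟨j₀, hj₀, hne⟩ := hnbr i
  refine le_trans (add_le_add ?_ ?_) (sq_sum_add_sum_erase_le (W i) j₀)
  · simp [Matrix.mulVec, dotProduct, sq]
  · rw [dotProduct, ← Finset.add_sum_erase _ _ (Finset.mem_univ j₀)]
    have h0 : projOn (Omega nbr) W i j₀ = 0 := by
      simp [projOn, Omega, hne, hj₀]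
    rw [h0, mul_zero, zero_add]
    refine Finset.sum_le_sum fun j _ => ?_
    by_cases h : (i, j) ∈ Omega nbr
    · simp [projOn, h, sq]
    · simp [projOn, h, sq_nonneg]

theorem exists_isFeasible {nbr : Fin N → Set (Fin N)} (hnbr : ∀ i, ∃ j ∈ nbr i, j ≠ i) :
    ∃ W, IsFeasible (Omega nbr) W := by
  choose f hf hne using hnbr
  refine ⟨Matrix.of fun i j => if j = f i then 1 else 0, ?_, ?_⟩
  · ext i
    simp [Matrix.mulVec, dotProduct]
  · ext i j
    by_cases h : j = f i
    · subst h
      simp [projOn, Omega, hf, hne]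
    · simp [projOn, h]

end Bounds

/-! ### Convexity and coercivity of the objective -/

section NuclearObjective

open scoped RealInnerProductSpace

variable {N : ℕ}

theorem convexOn_nuclearNorm_vec {lam : ℝ} (hlam : 0 ≤ lam) :
    ConvexOn ℝ Set.univ
      fun x : EuclideanSpace ℝ (Fin N × Fin N) => lam * nuclearNorm (vec.symm x) := by
  refine ⟨convex_univ, fun x _ z _ a c ha hc _ => ?_⟩
  have h := mul_le_mul_of_nonneg_left (nuclearNorm_convex (vec.symm x) (vec.symm z) ha hc) hlam
  simp only [map_add, map_smul, smul_eq_mul]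
  linarith

theorem norm_le_nuclearNorm (x : EuclideanSpace ℝ (Fin N × Fin N)) :
    ‖x‖ ≤ N * nuclearNorm (vec.symm x) := by
  obtain ⟨W, rfl⟩ := vec.surjective x
  rw [LinearEquiv.symm_apply_apply]
  have h0 := nuclearNorm_nonneg W
  refine abs_le_of_sq_le_sq' ?_ (by positivity) |>.2
  rw [norm_vec_sq, frobSq]
  calc ∑ i, ∑ j, W i j ^ 2 ≤ ∑ _i : Fin N, ∑ _j : Fin N, nuclearNorm W ^ 2 :=
        Finset.sum_le_sum fun i _ => Finset.sum_le_sum fun j _ =>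
          sq_le_sq' (abs_le.1 (abs_apply_le_nuclearNorm W i j)).1
            (abs_le.1 (abs_apply_le_nuclearNorm W i j)).2
    _ = (N * nuclearNorm W) ^ 2 := by simp; ring

/-- Optimal solutions exist, because the nuclear norm makes the objective coercive. -/
theorem exists_minimizer {lam : ℝ} (hlam : 0 < lam)
    {T : EuclideanSpace ℝ (Fin N × Fin N) →L[ℝ] EuclideanSpace ℝ (Fin N × Fin N)}
    (hT0 : ∀ x, 0 ≤ ⟪x, T x⟫)
    (hcont : Continuous (quadObj (fun x => lam * nuclearNorm (vec.symm x)) T))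
    {S : Set (EuclideanSpace ℝ (Fin N × Fin N))} (hS : IsClosed S) (hne : S.Nonempty) :
    ∃ x ∈ S, IsMinOn (quadObj (fun x => lam * nuclearNorm (vec.symm x)) T) S x := by
  obtain ⟨x₀, hx₀⟩ := hne
  set o := quadObj (fun x => lam * nuclearNorm (vec.symm x)) T with ho
  refine hcont.continuousOn.exists_isMinOn' hS hx₀ (Filter.Eventually.filter_mono inf_le_left ?_)
  filter_upwards [(tendsto_norm_cocompact_atTop
    (E := EuclideanSpace ℝ (Fin N × Fin N))).eventually_ge_atTop (N * (o x₀ / lam) + 1)] with x hx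
  have h1 := norm_le_nuclearNorm x
  have h2 : lam * nuclearNorm (vec.symm x) ≤ o x := by
    have := hT0 x
    simp only [ho, quadObj]
    linarith
  by_contra! hlt
  have h3 : nuclearNorm (vec.symm x) ≤ o x₀ / lam := by
    rw [le_div_iff₀ hlam]
    linarith
  have h4 : (N : ℝ) * nuclearNorm (vec.symm x) ≤ N * (o x₀ / lam) := by gcongr
  linarith

end NuclearObjective

/-! ### The proximal step -/

section Proximal

open scoped RealInnerProductSpace

/-- The variational inequality of a proximal point, from comparing `w` with points on the segment
towards `z` and letting them tend to `w`. -/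
theorem proximal_inequality {E : Type*} [NormedAddCommGroup E] [InnerProductSpace ℝ E]
    {g : E → ℝ} (hg : ConvexOn ℝ Set.univ g) {κ : ℝ} {w q : E}
    (hmin : ∀ z, g w + κ / 2 * ‖w - q‖ ^ 2 ≤ g z + κ / 2 * ‖z - q‖ ^ 2) (z : E) :
    g w - κ * ⟪w - q, z - w⟫ ≤ g z := by
  have key : ∀ n : ℕ, g w - κ * ⟪w - q, z - w⟫
      ≤ g z + κ / 2 * ‖z - w‖ ^ 2 * (1 / ((n : ℝ) + 1)) := by
    intro n
    set t : ℝ := 1 / ((n : ℝ) + 1) with ht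
    have ht0 : 0 < t := by positivity
    have ht1 : t ≤ 1 := by
      rw [ht, div_le_one (by positivity)]
      linarith [Nat.cast_nonneg (α := ℝ) n]
    have h1 := hmin ((1 - t) • w + t • z)
    have h2 := hg.2 (Set.mem_univ w) (Set.mem_univ z) (sub_nonneg.2 ht1) ht0.le (by ring)
    have h3 : (1 - t) • w + t • z - q = (w - q) + t • (z - w) := by module
    rw [h3, norm_add_sq_real, real_inner_smul_right, norm_smul, Real.norm_of_nonneg ht0.le] at h1
    simp only [smul_eq_mul] at h2
    refine le_of_mul_le_mul_left ?_ ht0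
    linarith
  have hlim := (tendsto_one_div_add_atTop_nhds_zero_nat (𝕜 := ℝ)).const_mul
    (κ / 2 * ‖z - w‖ ^ 2) |>.const_add (g z)
  simpa using ge_of_tendsto' hlim key

theorem IsIteration.isLinearizedALM {N : ℕ} {B : Fin N → Matrix (Fin N) (Fin N) ℝ} {lam η : ℝ}
    {Ω : Set (Fin N × Fin N)} {β : ℕ → ℝ} {W : ℕ → Matrix (Fin N) (Fin N) ℝ}
    {Y₁ : ℕ → Fin N → ℝ} {Y₂ : ℕ → Matrix (Fin N) (Fin N) ℝ}
    (h : IsIteration B lam η Ω β W Y₁ Y₂) (hlam : 0 ≤ lam) (hη : 0 < η) (hβ : ∀ k, 0 < β k) :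
    IsLinearizedALM (fun x => lam * nuclearNorm (vec.symm x)) (rowMul B) (constraintMap Ω)
      (stack 1 0) η β (fun k => vec (W k)) (fun k => stack (Y₁ k) (projOn Ω (Y₂ k))) := by
  refine ⟨fun k z => ?_, fun k => ?_⟩
  · have hκ : η * β k ≠ 0 := (mul_pos hη (hβ k)).ne'
    have hp := proximal_inequality (convexOn_nuclearNorm_vec hlam) (κ := η * β k)
      (w := vec (W (k + 1)))
      (q := vec (W k - (η * β k)⁻¹ • gradF B Ω (β k) (W k) (Y₁ k) (Y₂ k))) (fun z => by
        have := h.W_step k (Set.mem_univ (vec.symm z))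
        simp only [Set.mem_ofPred_eq, ← norm_vec_sq] at this
        simpa using this) z
    refine le_of_eq_of_le ?_ hp
    obtain ⟨Z, rfl⟩ := vec.surjective z
    rw [← map_sub vec Z, map_sub vec (W k), map_smul, ← sub_add,
      inner_add_left (vec (W (k + 1)) - vec (W k)), real_inner_smul_left (vec (gradF _ _ _ _ _ _)),
      inner_gradF, mul_add (η * β k), mul_inv_cancel_left₀ hκ]
    ring
  · rw [constraintMap_vec, stack_sub, stack_smul, stack_add, sub_zero, h.Y₁_step, h.Y₂_step]

end Proximal
end LGLRR

/-! ### Convergence for localized low-rank representation -/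

open LGLRR in
theorem theorem1 {N d p : ℕ}
    (X : Fin N → Matrix (Fin d) (Fin p) ℝ) (hX : ∀ i, LGLRR.IsStiefel (X i))
    (H : Fin N → Fin N → Matrix (Fin d) (Fin p) ℝ)
    (hH : ∀ i j, LGLRR.IsGrassmannLog (X i) (X j) (H i j))
    (nbr : Fin N → Set (Fin N)) (hnbr : ∀ i, ∃ j ∈ nbr i, j ≠ i)
    (lam : ℝ) (hlam : 0 < lam)
    (η : ℝ) (hη : (⨆ i, LGLRR.specNorm (LGLRR.gramB H i) ^ 2) + N + 1 ≤ η)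
    (β : ℕ → ℝ) (hβ0 : 0 < β 0)
    (hβsum : Tendsto (fun n => ∑ k ∈ Finset.range n, (β (k + 1))⁻¹) atTop atTop)
    (C₀ : ℝ) (hC₀ : 0 < C₀)
    (hβinc : ∀ k, C₀ * ((∑ i, LGLRR.specNorm (LGLRR.gramB H i) ^ 2) /
      (η - (⨆ i, LGLRR.specNorm (LGLRR.gramB H i) ^ 2) - N)) < β (k + 1) - β k)
    (W : ℕ → Matrix (Fin N) (Fin N) ℝ)
    (Y₁ : ℕ → Fin N → ℝ) (Y₂ : ℕ → Matrix (Fin N) (Fin N) ℝ)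
    (hiter : LGLRR.IsIteration (LGLRR.gramB H) lam η (LGLRR.Omega nbr) β W Y₁ Y₂) :
    ∃ Wopt : Matrix (Fin N) (Fin N) ℝ,
      LGLRR.IsOptimal (LGLRR.gramB H) lam (LGLRR.Omega nbr) Wopt ∧
      Tendsto W atTop (𝓝 Wopt) := by
  set B := LGLRR.gramB H with hB
  set M : ℝ := ⨆ i, LGLRR.specNorm (B i) ^ 2 with hM
  set S : ℝ := ∑ i, LGLRR.specNorm (B i) ^ 2 with hS
  set δ : ℝ := C₀ * (S / (η - M - N)) with hδ
  have hM0 : 0 ≤ M := Real.iSup_nonneg fun i => sq_nonneg _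
  have hS0 : 0 ≤ S := Finset.sum_nonneg fun i _ => sq_nonneg _
  have hN0 : (0 : ℝ) ≤ N := Nat.cast_nonneg N
  have hgap : 0 < η - M - N := by linarith
  have hδ0 : 0 ≤ δ := by positivity
  have hη0 : 0 < η := by linarith
  have hmono : Monotone β := monotone_nat_of_le_succ fun k => by linarith [hβinc k]
  have hβ : ∀ k, 0 < β k := fun k => hβ0.trans_le (hmono k.zero_le)
  have hdiv : Tendsto (fun n => ∑ k ∈ Finset.range n, (β k)⁻¹) atTop atTop :=
    tendsto_atTop_mono (fun n => Finset.sum_le_sum fun k _ =>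
      inv_anti₀ (hβ k) (hmono k.le_succ)) hβsum
  have hsymm := isSymmetric_rowMul (B := B) (gramB_transpose H)
  have hT0 : ∀ x, 0 ≤ inner ℝ x (rowMul B x) := by
    intro x
    obtain ⟨V, rfl⟩ := vec.surjective x
    rw [inner_rowMul]
    exact Finset.sum_nonneg fun i _ => gramB_quadratic_nonneg H i _
  have hg := convexOn_nuclearNorm_vec (N := N) hlam.le
  have hgc := hg.locallyLipschitz.continuous
  set ε : ℝ := 1 / (2 * ((N : ℝ) + 1)) with hε
  have hε0 : 0 < ε := by positivity
  -- if some `B i` is nonzero then `β → ∞`; otherwise the quadratic term is absent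
  have hsmall : ∀ᶠ k in atTop, (β k)⁻¹ * ∑ i, specNorm (B i) ≤ ε / 2 := by
    rcases hS0.eq_or_lt with h0 | hpos
    · have hzero : ∑ i, specNorm (B i) = 0 := by
        refine Finset.sum_eq_zero fun i hi => ?_
        have := (Finset.sum_eq_zero_iff_of_nonneg fun i _ => sq_nonneg _).1 h0.symm i hi
        simpa using this
      refine Eventually.of_forall fun k => ?_
      rw [hzero, mul_zero]
      positivity
    · have hδpos : 0 < δ := by positivity
      have hlow : ∀ k : ℕ, k * δ ≤ β k := by
        intro k
        induction k with
        | zero => simpa using hβ0.le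
        | succ k ih =>
          push_cast
          linarith [hβinc k]
      have htop : Tendsto β atTop atTop :=
        tendsto_atTop_mono hlow (tendsto_natCast_atTop_atTop.atTop_mul_const hδpos)
      have hlim : Tendsto (fun k => (β k)⁻¹ * ∑ i, specNorm (B i)) atTop (𝓝 0) := by
        simpa using htop.inv_tendsto_atTop.mul_const (∑ i, specNorm (B i))
      exact hlim.eventually_le_const (by positivity)
  have hc : ∀ᶠ k in atTop, ∀ x, ‖constraintMap (Omega nbr) x‖ ^ 2
      + (β k)⁻¹ * inner ℝ x (rowMul B x) + ε / 2 * ‖x‖ ^ 2 ≤ η * ‖x‖ ^ 2 := by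
    filter_upwards [hsmall] with k hk x
    have h1 := norm_constraintMap_sq_le hnbr x
    have h2 := mul_le_mul_of_nonneg_left (inner_rowMul_self_le B x) (inv_nonneg.2 (hβ k).le)
    have h3 := mul_le_mul_of_nonneg_right hk (sq_nonneg ‖x‖)
    have h4 : ((N : ℝ) + 1) * ‖x‖ ^ 2 ≤ η * ‖x‖ ^ 2 := by
      gcongr
      linarith
    rw [← hε] at h1
    linarith
  obtain ⟨W₀, hW₀⟩ := exists_isFeasible hnbr
  obtain ⟨x, hx, hmin⟩ := exists_minimizer hlam hT0 (continuous_quadObj hgc _)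
    (S := {x | constraintMap (Omega nbr) x = stack 1 0})
    (isClosed_eq (constraintMap _).continuous continuous_const)
    ⟨vec W₀, (constraintMap_eq_iff _ _).2 hW₀⟩
  obtain ⟨v, ⟨hv, hvmin⟩, hlim⟩ := (hiter.isLinearizedALM hlam.le hη0 hβ).tendsto_minimizer hg hgc
    hsymm hT0 hη0 hβ hmono hdiv (half_pos hε0) hc
    (by
      rw [hiter.Y₁_zero, hiter.Y₂_zero]
      have : projOn (Omega nbr) 0 = 0 := by ext i j; simp [projOn]
      rw [this, stack_zero])
    hx (fun z hz => hmin hz)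
  obtain ⟨V, rfl⟩ := vec.surjective v
  refine ⟨V, ⟨(constraintMap_eq_iff _ _).1 hv, fun W' hW' => ?_⟩, ?_⟩
  · rw [objective_eq_quadObj, objective_eq_quadObj]
    exact hvmin _ ((constraintMap_eq_iff _ _).2 hW')
  · simpa [Function.comp_def] using (continuous_vec_symm.tendsto _).comp hlim
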